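/- Let $d\in\mathbb{N}$ and let $\eta:\{(x,y)\in\mathbb{R}^d\times\mathbb{R}^d:x\neq y\}\to[0,\infty)$ be a weight function. Put $G=\{(x,y):x\ne y,\ \eta(x,y)>0\}$ (assumed Borel), and assume that $\eta$ is continuous on $G$ and symmetric, $\eta(x,y)=\eta(y,x)$ for $(x,y)\in G$. Let $\mu$ be a non-negative $\sigma$-finite Borel measure on $\mathbb{R}^d$ such that, for some constant $C_\eta\in(0,\infty)$, $$\textbf{(A1)}\qquad \sup_{x\in\mathbb{R}^d}\int \bigl(|x-y|^2\vee|x-y|^4\bigr)\,\eta(x,y)\,d\mu(y)\le C_\eta .$$ *Action.* Let $\rho$ be a Borel probability measure on $\mathbb{R}^d$ and $j=j^+-j^-$ a ($\sigma$-finite) signed Borel measure on $G$ with total variation measure $|j|=j^++j^-$. Put $$\mathcal{A}(\mu;\rho,j)=\frac12\iint_G\Bigl(\alpha\bigl(\tfrac{dj}{d\lambda},\tfrac{d(\rho\otimes\mu)}{d\lambda}\bigr)+\alpha\bigl(-\tfrac{dj}{d\lambda},\tfrac{d(\mu\otimes\rho)}{d\lambda}\bigr)\Bigr)\,\eta\,d\lambda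 ,$$ where $\lambda$ is any $\sigma$-finite measure on $G$ with respect to which $\rho\otimes\mu$, $\mu\otimes\rho$ (both restricted to $G$) and $|j|$ are absolutely continuous, for instance their sum. Here $\alpha(s,r)=(s_+)^2/r$ if $r>0$, $\alpha(s,0)=0$ if $s\le0$, and $\alpha(s,0)=\infty$ if $s>0$. *Nonlocal continuity equation.* For Borel probability measures $\rho^0,\rho^1$ on $\mathbb{R}^d$, let $\mathrm{CE}(\rho^0,\rho^1)$ be the set of pairs $(\rho_t,j_t)_{t\in[0,1]}$ such that $t\mapsto\rho_t$ is a narrowly continuous curve of probability measures on $\mathbb{R}^d$ with $\rho_0=\rho^0$ and $\rho_1=\rho^1$, $(j_t)_{t\in[0,1]}$ is a Borel family of signed measures on $G$ with $\int_0^1\iint_G(2\wedge|x-y|)\,\eta(x,y)\,d|j_t|(x,y)\,dt<\infty$, and $$\int_0^1\!\int_{\mathbb{R}^d}\partial_t\varphi_t(x)\,d\rho_t(x)\,dt+\frac12\int_0^1\!\iint_G\bigl(\varphi_t(y)-\varphi_t(x)\bigr)\,\eta(x,y)\,dj_t(x,y)\,dt=0$$ for all $\varphi\in C_c^\infty((0,1)\times\mathbb{R}^d)$.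 *Distances.* The nonlocal upwind transportation cost $\mathcal{T}_\mu(\rho^0,\rho^1)\in[0,\infty]$ is defined by $$\mathcal{T}_\mu(\rho^0,\rho^1)^2=\inf\Bigl\{\int_0^1\mathcal{A}(\mu;\rho_t,j_t)\,dt:\ (\rho,j)\in\mathrm{CE}(\rho^0,\rho^1)\Bigr\},\qquad \inf\emptyset=\infty,$$ and $W_1(\rho^0,\rho^1)=\inf_\pi\iint|x-y|\,d\pi(x,y)$ is the $1$-Wasserstein distance, the infimum being taken over all couplings $\pi$ of $\rho^0$ and $\rho^1$. **Proposition.** For all Borel probability measures $\rho^0,\rho^1$ on $\mathbb{R}^d$ with finite second moment, $$W_1(\rho^0,\rho^1)\le\sqrt{2C_\eta}\;\mathcal{T}_\mu(\rho^0,\rho^1).$$ -/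

import Mathlib

open MeasureTheory Set Topology
open scoped ENNReal NNReal ContDiff

noncomputable section

namespace NonlocalTransport

/-- The Euclidean space `ℝ^d`. -/
abbrev E (d : ℕ) : Type := EuclideanSpace ℝ (Fin d)

/-! ### Weight function and graph -/

/-- The set of edges `G = {(x, y) : x ≠ y, η (x, y) > 0}` of a weight function `η ≥ 0`.
The weight is a total function on pairs, but its values on the diagonal are never used. -/
def edgeSet {d : ℕ} (η : E d × E d → ℝ≥0) : Set (E d × E d) :=
  {p | p.1 ≠ p.2 ∧ 0 < η p}

/-- The standing assumption (W) on the weight function: continuity on `G` and symmetry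
(non-negativity is part of the type of `η`).  The set `G` is taken to be Borel, so that the
integrals over `G` make sense. -/
structure IsWeight {d : ℕ} (η : E d × E d → ℝ≥0) : Prop where
  measurableSet_edgeSet : MeasurableSet (edgeSet η)
  continuousOn : ContinuousOn η (edgeSet η)
  symm : ∀ p ∈ edgeSet η, η p.swap = η p

/-- Assumption (A1), the moment bound with constant `C`:
`sup_x ∫ (|x - y|² ∨ |x - y|⁴) η(x, y) dμ(y) ≤ C`.  The integrand vanishes at `y = x`. -/
def MomentBound {d : ℕ} (η : E d × E d → ℝ≥0) (μ : Measure (E d)) (C : ℝ) : Prop :=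
  ∀ x : E d,
    ∫⁻ y, ENNReal.ofReal (max (‖x - y‖ ^ 2) (‖x - y‖ ^ 4)) * (η (x, y) : ℝ≥0∞) ∂μ
      ≤ ENNReal.ofReal C

/-! ### Fluxes -/

/-- A signed Borel measure `j` on `G`, given by its Jordan decomposition `j = j⁺ - j⁻` into two
mutually singular non-negative measures.  As for the base measure `μ` (which may be the Lebesgue
measure), the total mass is allowed to be infinite; the parts are `σ`-finite. Measures on `G` are
regarded as measures on `ℝ^d × ℝ^d` that do not charge the complement of `G`. -/
structure Flux {d : ℕ} (G : Set (E d × E d)) where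
  pos : Measure (E d × E d)
  neg : Measure (E d × E d)
  sigmaFinite_pos : SigmaFinite pos
  sigmaFinite_neg : SigmaFinite neg
  mutuallySingular : pos ⟂ₘ neg
  pos_compl : pos Gᶜ = 0
  neg_compl : neg Gᶜ = 0

/-- The total variation measure `|j| = j⁺ + j⁻`. -/
def Flux.totalVariation {d : ℕ} {G : Set (E d × E d)} (j : Flux G) : Measure (E d × E d) :=
  j.pos + j.neg

/-- The integral `∬_G f dj = ∬_G f dj⁺ - ∬_G f dj⁻`. -/
def Flux.integral {d : ℕ} {G : Set (E d × E d)} (j : Flux G) (f : E d × E d → ℝ) : ℝ :=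
  (∫ p in G, f p ∂j.pos) - ∫ p in G, f p ∂j.neg

/-! ### Action -/

/-- The function `α(j, r)`, for `r ≥ 0`: `(j₊)² / r` if `r > 0`; `0` if `r = 0` and `j ≤ 0`;
`∞` if `r = 0` and `j > 0`. -/
def alpha (j r : ℝ) : ℝ≥0∞ :=
  if 0 < r then ENNReal.ofReal (max 0 j ^ 2 / r) else if j ≤ 0 then 0 else ⊤

/-- `γ₁ = ρ ⊗ μ`, restricted to `G`. -/
def gamma₁ {d : ℕ} (G : Set (E d × E d)) (μ ρ : Measure (E d)) : Measure (E d × E d) :=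
  (ρ.prod μ).restrict G

/-- `γ₂ = μ ⊗ ρ`, restricted to `G`. -/
def gamma₂ {d : ℕ} (G : Set (E d × E d)) (μ ρ : Measure (E d)) : Measure (E d × E d) :=
  (μ.prod ρ).restrict G

/-- The expression defining the action, computed with the reference measure `lam`:
`½ ∬_G (α(dj/dλ, dγ₁/dλ) + α(-dj/dλ, dγ₂/dλ)) η dλ`. -/
def actionWith {d : ℕ} (η : E d × E d → ℝ≥0) (lam : Measure (E d × E d))
    (μ ρ : Measure (E d)) (j : Flux (edgeSet η)) : ℝ≥0∞ :=
  (1 / 2 : ℝ≥0∞) * ∫⁻ p in edgeSet η,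
    (alpha ((j.pos.rnDeriv lam p).toReal - (j.neg.rnDeriv lam p).toReal)
        ((gamma₁ (edgeSet η) μ ρ).rnDeriv lam p).toReal
      + alpha (-((j.pos.rnDeriv lam p).toReal - (j.neg.rnDeriv lam p).toReal))
        ((gamma₂ (edgeSet η) μ ρ).rnDeriv lam p).toReal) * (η p : ℝ≥0∞) ∂lam

/-- The action `𝒜(μ; ρ, j)`.  By the one-homogeneity of `α`, the expression `actionWith` does not
depend on the (`σ`-finite) reference measure as long as `γ₁`, `γ₂` and `|j|` are absolutely
continuous with respect to it; the choice made here is `λ = γ₁ + γ₂ + |j|`. -/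
def action {d : ℕ} (η : E d × E d → ℝ≥0) (μ ρ : Measure (E d)) (j : Flux (edgeSet η)) : ℝ≥0∞ :=
  actionWith η (gamma₁ (edgeSet η) μ ρ + gamma₂ (edgeSet η) μ ρ + j.totalVariation) μ ρ j

/-! ### Nonlocal continuity equation -/

/-- The nonlocal gradient `∇̄ϕ(x, y) = ϕ(y) - ϕ(x)`. -/
def nonlocalGrad {d : ℕ} (ϕ : E d → ℝ) (p : E d × E d) : ℝ := ϕ p.2 - ϕ p.1

/-- `(ρ, j)` is a weak solution of the nonlocal continuity equation `∂ₜρₜ + ∇̄ · jₜ = 0` on `[0, T]`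
(only the values at times in `[0, T]` matter).  The integrability condition is the one under which
all the integrals in the weak formulation are defined. -/
structure IsWeakSolution {d : ℕ} (η : E d × E d → ℝ≥0) (T : ℝ)
    (ρ : ℝ → ProbabilityMeasure (E d)) (j : ℝ → Flux (edgeSet η)) : Prop where
  /-- `t ↦ ρₜ` is a weakly (i.e. narrowly) continuous curve. -/
  continuousOn : ContinuousOn ρ (Icc 0 T)
  /-- `t ↦ jₜ` is a Borel family of measures. -/
  measurable_pos : ∀ A : Set (E d × E d), MeasurableSet A →
    Measurable fun t : Icc (0 : ℝ) T => (j t).pos A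
  measurable_neg : ∀ A : Set (E d × E d), MeasurableSet A →
    Measurable fun t : Icc (0 : ℝ) T => (j t).neg A
  /-- `∫₀ᵀ ∬_G (2 ∧ |x - y|) η d|jₜ| dt < ∞`. -/
  integrability : ∫⁻ t in Ioo 0 T, ∫⁻ p in edgeSet η,
    ENNReal.ofReal (min 2 ‖p.1 - p.2‖) * (η p : ℝ≥0∞) ∂(j t).totalVariation < ⊤
  /-- The weak formulation, for every test function in `C_c^∞((0, T) × ℝ^d)`. -/
  weak : ∀ φ : ℝ × E d → ℝ, ContDiff ℝ ∞ φ → HasCompactSupport φ →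
    tsupport φ ⊆ Ioo 0 T ×ˢ univ →
    (∫ t in Ioo 0 T, ∫ x, deriv (fun s => φ (s, x)) t ∂(ρ t : Measure (E d)))
      + (1 / 2 : ℝ) * ∫ t in Ioo 0 T,
          (j t).integral (fun p => nonlocalGrad (fun x => φ (t, x)) p * (η p : ℝ)) = 0

/-- `(ρ, j) ∈ CE(ρ⁰, ρ¹)`: weak solutions on `[0, 1]` that connect `ρ⁰` to `ρ¹`. -/
def CE {d : ℕ} (η : E d × E d → ℝ≥0) (ρ₀ ρ₁ : ProbabilityMeasure (E d)) :
    Set ((ℝ → ProbabilityMeasure (E d)) × (ℝ → Flux (edgeSet η))) :=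
  {c | IsWeakSolution η 1 c.1 c.2 ∧ c.1 0 = ρ₀ ∧ c.1 1 = ρ₁}

/-! ### Distances -/

/-- The nonlocal upwind transportation cost `𝒯_μ(ρ⁰, ρ¹) ∈ [0, ∞]`, defined by
`𝒯_μ(ρ⁰, ρ¹)² = inf {∫₀¹ 𝒜(μ; ρₜ, jₜ) dt : (ρ, j) ∈ CE(ρ⁰, ρ¹)}` (with `inf ∅ = ∞`). -/
def upwindCost {d : ℕ} (η : E d × E d → ℝ≥0) (μ : Measure (E d))
    (ρ₀ ρ₁ : ProbabilityMeasure (E d)) : ℝ≥0∞ :=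
  (⨅ c ∈ CE η ρ₀ ρ₁, ∫⁻ t in Icc (0 : ℝ) 1, action η μ (c.1 t : Measure (E d)) (c.2 t))
    ^ (1 / 2 : ℝ)

/-- Finite second moment: `ρ ∈ 𝒫₂(ℝ^d)`. -/
def HasFiniteSecondMoment {d : ℕ} (ρ : ProbabilityMeasure (E d)) : Prop :=
  ∫⁻ x, ENNReal.ofReal (‖x‖ ^ 2) ∂(ρ : Measure (E d)) < ⊤

/-- The `1`-Wasserstein (Monge-Kantorovich) distance: the infimum of `∬ |x - y| dπ(x, y)` over all
couplings `π` of `ρ⁰` and `ρ¹`. -/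
def wasserstein₁ {d : ℕ} (ρ₀ ρ₁ : ProbabilityMeasure (E d)) : ℝ≥0∞ :=
  ⨅ π ∈ {π : Measure (E d × E d) | π.map Prod.fst = ρ₀ ∧ π.map Prod.snd = ρ₁},
    ∫⁻ p, ENNReal.ofReal ‖p.1 - p.2‖ ∂π

end NonlocalTransport

end

noncomputable section

namespace NonlocalTransport

-- By Kantorovich–Rubinstein duality it suffices to bound `∫ ψ dρ₁ - ∫ ψ dρ₀` for 1-Lipschitz `ψ ∈
-- C_c^∞`. Testing the continuity equation with `θ(t) ψ(x)`, where the cutoff `θ` tends to 1,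
-- identifies this difference with half the time integral of `∬ (ψ(y) - ψ(x)) η dj_t`, hence bounds
-- it by `½ ∫∬ |x - y| η d|j_t| dt` (`IsWeakSolution.integral_sub_le`).
--
-- The weighted flux is controlled by the action through a Cauchy–Schwarz argument in the form of
-- Young's inequality `2as ≤ κ s²/r + κ⁻¹ a² r`, with `j⁺` compared to `ρ ⊗ μ` and `j⁻` to `μ ⊗ ρ`
-- (`two_mul_lintegral_le_action`). By (A1), each of these measures gives `|x - y|² η` integral at
-- most `C`. For a curve of total action at most `A`, the flux is at most `κA + C/κ`, and the best
-- `κ` gives `2√(CA)`. After the factor ½ this is `√C √A`, which is sharper than the claim by `√2`.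
--
-- The required direction of duality is proved from scratch: Hahn–Banach gives it for finitely many
-- points (`exists_plan_of_dual_le`). Quantizing both measures by one simple function then gives it
-- for all Lipschitz potentials, and cone truncation and mollification reduce to smooth compactly
-- supported ones.

-- Finite Kantorovich duality and lifting of discrete plans

/-- Duality for the finite Kantorovich problem: if every pair of admissible dual potentials has
value at most `K`, then there is a transport plan with cost at most `K`. -/
theorem exists_plan_of_dual_le {ι κ : Type*} [Fintype ι] [Fintype κ]
    {a : ι → ℝ} {b : κ → ℝ} (ha : ∀ i, 0 ≤ a i) (hb : ∀ j, 0 ≤ b j)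
    (ha1 : ∑ i, a i = 1) (hb1 : ∑ j, b j = 1) (c : ι → κ → ℝ) (K : ℝ)
    (hK : ∀ (f : ι → ℝ) (g : κ → ℝ), (∀ i j, f i + g j ≤ c i j) →
      ∑ i, a i * f i + ∑ j, b j * g j ≤ K) :
    ∃ w : ι → κ → ℝ, (∀ i j, 0 ≤ w i j) ∧ (∀ i, ∑ j, w i j = a i) ∧ (∀ j, ∑ i, w i j = b j) ∧
      ∑ i, ∑ j, w i j * c i j ≤ K := by
  classical
  let L : (ι × κ → ℝ) →ₗ[ℝ] (ι → ℝ) × (κ → ℝ) × ℝ :=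
    { toFun := fun w => (fun i => ∑ j, w (i, j), fun j => ∑ i, w (i, j),
        ∑ i, ∑ j, w (i, j) * c i j)
      map_add' := fun w v => by
        ext <;> simp [Finset.sum_add_distrib, add_mul]
      map_smul' := fun r w => by
        ext <;> simp [Finset.mul_sum, mul_assoc] }
  have hLc : Continuous L := L.continuous_of_finiteDimensional
  let S := L '' stdSimplex ℝ (ι × κ)
  let Q : Set ((ι → ℝ) × (κ → ℝ) × ℝ) := {a} ×ˢ {b} ×ˢ Iic K
  -- A common point of `S` and `Q` is exactly the desired plan. Otherwise the two convex sets are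
  -- strictly separated, and the separating functional yields dual potentials violating `hK`.
  by_cases hdisj : Disjoint S Q
  · exfalso
    obtain ⟨F, u, v, hS, huv, hQ⟩ := geometric_hahn_banach_compact_closed
      ((convex_stdSimplex ℝ (ι × κ)).linear_image L) ((isCompact_stdSimplex ℝ (ι × κ)).image hLc)
      ((convex_singleton a).prod ((convex_singleton b).prod (convex_Iic K)))
      (isClosed_singleton.prod (isClosed_singleton.prod isClosed_Iic)) hdisj
    let f : ι → ℝ := fun i => F (Pi.single i 1, 0, 0)
    let g : κ → ℝ := fun j => F (0, Pi.single j 1, 0)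
    let s : ℝ := F (0, 0, 1)
    have hF : ∀ (x : ι → ℝ) (y : κ → ℝ) (r : ℝ),
        F (x, y, r) = ∑ i, x i * f i + ∑ j, y j * g j + r * s := by
      intro x y r
      have h1 : (x, y, r) = ∑ i, x i • ((Pi.single i 1, 0, 0) : (ι → ℝ) × (κ → ℝ) × ℝ)
          + ∑ j, y j • ((0, Pi.single j 1, 0) : (ι → ℝ) × (κ → ℝ) × ℝ) + r • (0, 0, 1) := by
        ext <;> simp [Prod.fst_sum, Prod.snd_sum, Finset.sum_apply, Pi.single_apply]
      rw [h1]
      simp only [map_add, map_sum, map_smul, smul_eq_mul, f, g, s]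
    have hS' : ∀ i j, f i + g j + c i j * s < u := by
      intro i j
      have h := hS (L (Pi.single (i, j) 1)) ⟨_, single_mem_stdSimplex ℝ (i, j), rfl⟩
      have h2 : L (Pi.single (i, j) 1) = (Pi.single i 1, Pi.single j 1, c i j) := by
        ext k
        · simp only [L, LinearMap.coe_mk, AddHom.coe_mk]
          rw [Finset.sum_eq_single j] <;> simp +contextual [Pi.single_apply]
        · simp only [L, LinearMap.coe_mk, AddHom.coe_mk]
          rw [Finset.sum_eq_single i] <;> simp +contextual [Pi.single_apply]
        · simp only [L, LinearMap.coe_mk, AddHom.coe_mk]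
          rw [Finset.sum_eq_single i, Finset.sum_eq_single j] <;>
            simp +contextual [Pi.single_apply]
      rw [h2, hF] at h
      simpa [Pi.single_apply] using h
    have hQ' : ∀ r ≤ K, v < ∑ i, a i * f i + ∑ j, b j * g j + r * s := by
      intro r hr
      rw [← hF]
      exact hQ _ ⟨rfl, rfl, hr⟩
    set A := ∑ i, a i * f i + ∑ j, b j * g j with hA
    -- The cost coordinate of `Q` is unbounded below, so a positive `s` would push `F` below `v`.
    have hs : s ≤ 0 := by
      by_contra! hs
      have h := hQ' (min K ((v - A) / s)) (min_le_left _ _)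
      have h2 : min K ((v - A) / s) * s ≤ (v - A) / s * s :=
        mul_le_mul_of_nonneg_right (min_le_right _ _) hs.le
      rw [div_mul_cancel₀ _ hs.ne'] at h2
      linarith
    have hKs := hQ' K le_rfl
    -- If `s = 0`, averaging `f i + g j < u` against the product plan `a ⊗ b` gives `A ≤ u < v < A`.
    -- If `s < 0`, dividing by `-s` makes the potentials admissible; the constant `u` is absorbed
    -- into `g` because `b` has mass 1.
    rcases hs.eq_or_lt with hs | hs
    · have h1 : A = ∑ i, ∑ j, a i * b j * (f i + g j) := by
        simp only [mul_add, Finset.sum_add_distrib, hA]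
        congr 1
        · refine Finset.sum_congr rfl fun i _ => ?_
          simp only [mul_right_comm _ _ (f i)]
          rw [← Finset.mul_sum, hb1, mul_one]
        · rw [Finset.sum_comm]
          refine Finset.sum_congr rfl fun j _ => ?_
          simp only [mul_assoc]
          rw [← Finset.sum_mul, ha1, one_mul]
      have h2 : ∑ i, ∑ j, a i * b j * (f i + g j) ≤ ∑ i, ∑ j, a i * b j * u := by
        refine Finset.sum_le_sum fun i _ => Finset.sum_le_sum fun j _ =>
          mul_le_mul_of_nonneg_left ?_ (mul_nonneg (ha i) (hb j))
        have := hS' i j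
        rw [hs] at this
        linarith
      have h3 : ∑ i, ∑ j, a i * b j * u = u := by
        simp only [mul_assoc, ← Finset.mul_sum, ← Finset.sum_mul, ha1, hb1, one_mul]
      rw [hs] at hKs
      linarith
    · have hs' : 0 < -s := neg_pos.2 hs
      have h := hK (fun i => f i / -s) (fun j => (g j - u) / -s) fun i j => by
        rw [← add_div, div_le_iff₀ hs']
        linarith [hS' i j]
      have h1 : ∑ i, a i * (f i / -s) + ∑ j, b j * ((g j - u) / -s) = (A - u) / -s := by
        simp only [← mul_div_assoc, ← Finset.sum_div, mul_sub, Finset.sum_sub_distrib,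
          ← Finset.sum_mul, hb1, hA]
        ring
      rw [h1, div_le_iff₀ hs'] at h
      linarith
  · obtain ⟨q, ⟨w, hw, rfl⟩, hq⟩ := Set.not_disjoint_iff.1 hdisj
    obtain ⟨h1, h2, h3⟩ := hq
    exact ⟨fun i j => w (i, j), fun i j => hw.1 _, fun i => congrFun h1 i,
      fun j => congrFun h2 j, h3⟩

open ProbabilityTheory in
/-- A transport plan between the laws of a finite-valued map `T` under `ρ₀` and `ρ₁` lifts to a
coupling of `ρ₀` and `ρ₁`. -/
theorem exists_coupling_of_plan {α ι : Type*} [MeasurableSpace α] [Fintype ι] [MeasurableSpace ι]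
    [DiscreteMeasurableSpace ι] {ρ₀ ρ₁ : Measure α} [IsProbabilityMeasure ρ₀]
    [IsProbabilityMeasure ρ₁] {T : α → ι} (hT : Measurable T) {w : ι → ι → ℝ}
    (hw : ∀ i j, 0 ≤ w i j) (hw₀ : ∀ i, ∑ j, w i j = ρ₀.real (T ⁻¹' {i}))
    (hw₁ : ∀ j, ∑ i, w i j = ρ₁.real (T ⁻¹' {j})) :
    ∃ π : Measure (α × α), π.map Prod.fst = ρ₀ ∧ π.map Prod.snd = ρ₁ ∧
      ∀ c : ι → ι → ℝ≥0∞,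
        ∫⁻ p, c (T p.1) (T p.2) ∂π ≤ ∑ i, ∑ j, ENNReal.ofReal (w i j) * c i j := by
  have hm : ∀ i, MeasurableSet (T ⁻¹' {i}) := fun i => hT (measurableSet_singleton i)
  have hsum : ∀ (ρ : Measure α) [IsProbabilityMeasure ρ],
      ∑ i, ρ (T ⁻¹' {i}) • ρ[|T ⁻¹' {i}] = ρ := by
    intro ρ _
    ext s hs
    simp only [Measure.coe_finsetSum, Finset.sum_apply, Measure.smul_apply, smul_eq_mul]
    have h1 : ∀ i, ρ (T ⁻¹' {i}) * ρ[s|T ⁻¹' {i}] = ρ (s ∩ T ⁻¹' {i}) := fun i => by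
      rw [mul_comm, cond_mul_eq_inter (hm i), inter_comm]
    simp only [h1]
    rw [← measure_biUnion_finset]
    · congr 1
      ext x
      simp
    · intro i _ j _ hij
      exact Disjoint.mono inter_subset_right inter_subset_right
        (Disjoint.preimage T (disjoint_singleton.2 hij))
    · exact fun i _ => hs.inter (hm i)
  have hrow : ∀ i, ∑ j, ENNReal.ofReal (w i j) = ρ₀ (T ⁻¹' {i}) := fun i => by
    rw [← ENNReal.ofReal_sum_of_nonneg fun j _ => hw i j, hw₀, ofReal_measureReal]
  have hcol : ∀ j, ∑ i, ENNReal.ofReal (w i j) = ρ₁ (T ⁻¹' {j}) := fun j => by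
    rw [← ENNReal.ofReal_sum_of_nonneg fun i _ => hw i j, hw₁, ofReal_measureReal]
  -- A null cell has zero conditional measure rather than a probability, but a plan with the right
  -- marginals puts no weight there.
  have hw0 : ∀ i j, ρ₀ (T ⁻¹' {i}) = 0 → ENNReal.ofReal (w i j) = 0 := fun i j h => by
    rw [← hrow i] at h
    exact (Finset.sum_eq_zero_iff.1 h) j (Finset.mem_univ j)
  have hw1 : ∀ i j, ρ₁ (T ⁻¹' {j}) = 0 → ENNReal.ofReal (w i j) = 0 := fun i j h => by
    rw [← hcol j] at h
    exact (Finset.sum_eq_zero_iff.1 h) i (Finset.mem_univ i)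
  have hfst : ∀ i j, ENNReal.ofReal (w i j) • (ρ₁[|T ⁻¹' {j}]) univ • ρ₀[|T ⁻¹' {i}]
      = ENNReal.ofReal (w i j) • ρ₀[|T ⁻¹' {i}] := fun i j => by
    by_cases h : ρ₁ (T ⁻¹' {j}) = 0
    · simp [hw1 i j h]
    · have := cond_isProbabilityMeasure (μ := ρ₁) h
      rw [measure_univ, one_smul]
  have hsnd : ∀ i j, ENNReal.ofReal (w i j) • (ρ₀[|T ⁻¹' {i}]) univ • ρ₁[|T ⁻¹' {j}]
      = ENNReal.ofReal (w i j) • ρ₁[|T ⁻¹' {j}] := fun i j => by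
    by_cases h : ρ₀ (T ⁻¹' {i}) = 0
    · simp [hw0 i j h]
    · have := cond_isProbabilityMeasure (μ := ρ₀) h
      rw [measure_univ, one_smul]
  -- Inside each pair of cells the mass `w i j` is spread as the product of the conditional laws;
  -- the marginals are then restored by the law of total probability.
  refine ⟨∑ i, ∑ j, ENNReal.ofReal (w i j) • (ρ₀[|T ⁻¹' {i}]).prod (ρ₁[|T ⁻¹' {j}]),
    ?_, ?_, fun c => ?_⟩
  · simp only [← Measure.mapₗ_apply_of_measurable measurable_fst, map_sum, map_smul]
    simp only [Measure.mapₗ_apply_of_measurable measurable_fst, Measure.map_fst_prod, hfst,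
      ← Finset.sum_smul, hrow, hsum]
  · simp only [← Measure.mapₗ_apply_of_measurable measurable_snd, map_sum, map_smul]
    rw [Finset.sum_comm]
    simp only [Measure.mapₗ_apply_of_measurable measurable_snd, Measure.map_snd_prod, hsnd,
      ← Finset.sum_smul, hcol, hsum]
  · simp only [lintegral_finsetSum_measure, lintegral_smul_measure, smul_eq_mul]
    refine Finset.sum_le_sum fun i _ => Finset.sum_le_sum fun j _ => ?_
    gcongr
    have hc : Measurable fun p : α × α => c (T p.1) (T p.2) :=
      (measurable_of_finite (fun q : ι × ι => c q.1 q.2)).comp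
        ((hT.comp measurable_fst).prodMk (hT.comp measurable_snd))
    rw [lintegral_prod _ hc.aemeasurable]
    have hone : ∀ (ρ : Measure α) [IsProbabilityMeasure ρ] (i : ι),
        (ρ[|T ⁻¹' {i}]) univ ≤ 1 := fun ρ _ i => by
      by_cases h : ρ (T ⁻¹' {i}) = 0
      · simp [cond_eq_zero_of_meas_eq_zero h]
      · have := cond_isProbabilityMeasure (μ := ρ) h
        rw [measure_univ]
    calc ∫⁻ x, ∫⁻ y, c (T x) (T y) ∂ρ₁[|T ⁻¹' {j}] ∂ρ₀[|T ⁻¹' {i}]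
        = ∫⁻ x, ∫⁻ y, c i j ∂ρ₁[|T ⁻¹' {j}] ∂ρ₀[|T ⁻¹' {i}] := by
          refine lintegral_congr_ae ?_
          filter_upwards [ae_cond_mem (μ := ρ₀) (hm i)] with x hx
          refine lintegral_congr_ae ?_
          filter_upwards [ae_cond_mem (μ := ρ₁) (hm j)] with y hy
          rw [mem_preimage, mem_singleton_iff] at hx hy
          rw [hx, hy]
      _ ≤ c i j := by
          rw [lintegral_const, lintegral_const, mul_assoc]
          exact mul_le_of_le_one_right' (mul_le_one' (hone ρ₁ j) (hone ρ₀ i))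

-- Kantorovich–Rubinstein duality by quantization

theorem _root_.LipschitzWith.integrable_of_integrable_id {V : Type*} [NormedAddCommGroup V]
    [MeasurableSpace V] [BorelSpace V] {ρ : Measure V} [IsFiniteMeasure ρ]
    (hρ : Integrable (fun x : V => x) ρ) {h : V → ℝ} (hh : LipschitzWith 1 h) :
    Integrable h ρ := by
  refine ((integrable_const ‖h 0‖).add hρ.norm).mono'
    hh.continuous.measurable.aestronglyMeasurable (ae_of_all _ fun x => ?_)
  have := hh.dist_le_mul x 0
  rw [dist_eq_norm, dist_zero_right, NNReal.coe_one, one_mul] at this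
  have h2 := norm_sub_norm_le (h x) (h 0)
  simp only [Pi.add_apply]
  linarith

theorem abs_integral_comp_simpleFunc_sub_le {V : Type*} [NormedAddCommGroup V]
    [MeasurableSpace V] [BorelSpace V] {ρ : Measure V} [IsFiniteMeasure ρ]
    (hρ : Integrable (fun x : V => x) ρ) {h : V → ℝ} (hh : LipschitzWith 1 h)
    (T : SimpleFunc V V) {ε : ℝ} (hε : 0 ≤ ε)
    (hT : ∫⁻ x, ‖T x - x‖ₑ ∂ρ ≤ ENNReal.ofReal ε) :
    |∫ x, h (T x) ∂ρ - ∫ x, h x ∂ρ| ≤ ε := by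
  have h1 : Integrable (fun x => h (T x)) ρ := (T.map h).integrable_of_isFiniteMeasure
  rw [← integral_sub h1 (hh.integrable_of_integrable_id hρ), ← Real.norm_eq_abs,
    ← ENNReal.ofReal_le_ofReal_iff hε, ofReal_norm]
  refine (enorm_integral_le_lintegral_enorm _).trans ((lintegral_mono fun x => ?_).trans hT)
  have := hh.edist_le_mul (T x) x
  rwa [ENNReal.coe_one, one_mul, edist_eq_enorm_sub, edist_eq_enorm_sub] at this

/-- The Lipschitz potential `y ↦ min_i (‖i - y‖ - f i)`. -/
theorem exists_lipschitz_potential {V : Type*} [NormedAddCommGroup V] (F : Finset V)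
    (hF : F.Nonempty) (f g : F → ℝ) (hfg : ∀ i j : F, f i + g j ≤ ‖(i : V) - j‖) :
    ∃ h : V → ℝ, LipschitzWith 1 h ∧ (∀ i : F, h i ≤ -f i) ∧ ∀ j : F, g j ≤ h j := by
  have hne : (Finset.univ : Finset F).Nonempty := by simpa using hF
  -- This is the c-transform of `f`: the term `i` itself gives `h i ≤ -f i`, and admissibility of
  -- `(f, g)` says that every term at `j` is at least `g j`.
  refine ⟨fun y => Finset.univ.inf' hne fun i : F => ‖(i : V) - y‖ - f i, ?_, fun i => ?_,
    fun j => ?_⟩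
  · refine LipschitzWith.of_le_add fun x y => ?_
    rw [← sub_le_iff_le_add]
    refine Finset.le_inf' _ _ fun i hi => ?_
    have h1 := Finset.inf'_le (fun i : F => ‖(i : V) - x‖ - f i) hi
    have h2 : ‖(i : V) - x‖ ≤ ‖(i : V) - y‖ + dist x y := by
      rw [← dist_eq_norm, ← dist_eq_norm, dist_comm x y]
      exact dist_triangle _ _ _
    linarith
  · refine (Finset.inf'_le _ (Finset.mem_univ i)).trans ?_
    simp
  · exact Finset.le_inf' _ _ fun i _ => by linarith [hfg i j]

variable {d : ℕ}

/-- Dual potentials of the problem between the quantized laws extend to one Lipschitz `h`; replacing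
`h ∘ T` by `h` costs `ε` per measure, so the discrete cost is at most `K + 2ε`. In the lifted
coupling, the displacement between each endpoint and its image under `T` costs another `ε` per
marginal, which accounts for `4ε`. -/
theorem wasserstein₁_le_of_simpleFunc {ρ₀ ρ₁ : ProbabilityMeasure (E d)}
    (h₀ : Integrable (fun x : E d => x) (ρ₀ : Measure (E d)))
    (h₁ : Integrable (fun x : E d => x) (ρ₁ : Measure (E d))) {K : ℝ}
    (hK : ∀ h : E d → ℝ, LipschitzWith 1 h →
      ∫ x, h x ∂(ρ₁ : Measure (E d)) - ∫ x, h x ∂(ρ₀ : Measure (E d)) ≤ K)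
    (T : SimpleFunc (E d) (E d)) {ε : ℝ} (hε : 0 ≤ ε)
    (hT₀ : ∫⁻ x, ‖T x - x‖ₑ ∂(ρ₀ : Measure (E d)) ≤ ENNReal.ofReal ε)
    (hT₁ : ∫⁻ x, ‖T x - x‖ₑ ∂(ρ₁ : Measure (E d)) ≤ ENNReal.ofReal ε) :
    wasserstein₁ ρ₀ ρ₁ ≤ ENNReal.ofReal (K + 4 * ε) := by
  have hK0 : 0 ≤ K := by simpa using hK 0 (LipschitzWith.const' 0)
  have hne : T.range.Nonempty := ⟨T 0, T.mem_range_self 0⟩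
  let S : E d → T.range := fun x => ⟨T x, T.mem_range_self x⟩
  have hS : Measurable S := T.measurable.subtype_mk
  have hSpre : ∀ i : T.range, S ⁻¹' {i} = T ⁻¹' {(i : E d)} := fun i => by
    ext x
    simp [S, Subtype.ext_iff]
  have hsum : ∀ (ρ : ProbabilityMeasure (E d)) (h : E d → ℝ),
      ∑ i : T.range, (ρ : Measure (E d)).real (T ⁻¹' {(i : E d)}) * h i
        = ∫ x, h (T x) ∂(ρ : Measure (E d)) := by
    intro ρ h
    have := Measure.isProbabilityMeasure_map (μ := (ρ : Measure (E d))) hS.aemeasurable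
    have h1 := integral_map (μ := (ρ : Measure (E d))) hS.aemeasurable
      (f := fun i : T.range => h i) (measurable_of_finite _).aestronglyMeasurable
    rw [integral_fintype .of_finite] at h1
    simpa only [map_measureReal_apply hS (measurableSet_singleton _), hSpre, smul_eq_mul]
      using h1
  have hprob : ∀ ρ : ProbabilityMeasure (E d),
      ∑ i : T.range, (ρ : Measure (E d)).real (T ⁻¹' {(i : E d)}) = 1 := fun ρ => by
    simpa using hsum ρ 1
  obtain ⟨w, hw, hw₀, hw₁, hwK⟩ := exists_plan_of_dual_le
    (a := fun i : T.range => (ρ₀ : Measure (E d)).real (T ⁻¹' {(i : E d)}))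
    (b := fun i : T.range => (ρ₁ : Measure (E d)).real (T ⁻¹' {(i : E d)}))
    (fun _ => measureReal_nonneg) (fun _ => measureReal_nonneg) (hprob ρ₀) (hprob ρ₁)
    (fun i j => ‖(i : E d) - j‖) (K + 2 * ε) fun f g hfg => by
      obtain ⟨h, hLip, hf, hg⟩ := exists_lipschitz_potential T.range hne f g hfg
      have e₀ := abs_le.1 (abs_integral_comp_simpleFunc_sub_le h₀ hLip T hε hT₀)
      have e₁ := abs_le.1 (abs_integral_comp_simpleFunc_sub_le h₁ hLip T hε hT₁)
      have h1 : ∑ i : T.range, (ρ₀ : Measure (E d)).real (T ⁻¹' {(i : E d)}) * f i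
          ≤ ∑ i : T.range, (ρ₀ : Measure (E d)).real (T ⁻¹' {(i : E d)}) * -h i :=
        Finset.sum_le_sum fun i _ => mul_le_mul_of_nonneg_left (by linarith [hf i])
          measureReal_nonneg
      have h2 : ∑ i : T.range, (ρ₁ : Measure (E d)).real (T ⁻¹' {(i : E d)}) * g i
          ≤ ∑ i : T.range, (ρ₁ : Measure (E d)).real (T ⁻¹' {(i : E d)}) * h i :=
        Finset.sum_le_sum fun i _ => mul_le_mul_of_nonneg_left (hg i) measureReal_nonneg
      simp only [mul_neg, Finset.sum_neg_distrib] at h1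
      rw [hsum] at h1 h2
      linarith [hK h hLip]
  obtain ⟨π, hπ₀, hπ₁, hπc⟩ := exists_coupling_of_plan (ρ₀ := (ρ₀ : Measure (E d)))
    (ρ₁ := (ρ₁ : Measure (E d))) hS hw (fun i => by rw [hSpre]; exact hw₀ i)
    (fun i => by rw [hSpre]; exact hw₁ i)
  have hmT : Measurable fun x => ‖T x - x‖ₑ := (T.measurable.sub measurable_id).enorm
  have c₀ : ∫⁻ p, ‖T p.1 - p.1‖ₑ ∂π ≤ ENNReal.ofReal ε := by
    rw [← hπ₀, lintegral_map hmT measurable_fst] at hT₀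
    exact hT₀
  have c₁ : ∫⁻ p, ‖T p.2 - p.2‖ₑ ∂π ≤ ENNReal.ofReal ε := by
    rw [← hπ₁, lintegral_map hmT measurable_snd] at hT₁
    exact hT₁
  have c : ∫⁻ p, ‖T p.1 - T p.2‖ₑ ∂π ≤ ENNReal.ofReal (K + 2 * ε) := by
    refine (hπc fun i j => ‖(i : E d) - j‖ₑ).trans ?_
    refine le_trans (le_of_eq ?_) (ENNReal.ofReal_le_ofReal hwK)
    rw [ENNReal.ofReal_sum_of_nonneg fun i _ => Finset.sum_nonneg fun j _ =>
      mul_nonneg (hw i j) (norm_nonneg _)]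
    refine Finset.sum_congr rfl fun i _ => ?_
    rw [ENNReal.ofReal_sum_of_nonneg fun j _ => mul_nonneg (hw i j) (norm_nonneg _)]
    refine Finset.sum_congr rfl fun j _ => ?_
    rw [ENNReal.ofReal_mul (hw i j), ofReal_norm]
  refine (iInf₂_le π ⟨hπ₀, hπ₁⟩).trans ?_
  calc ∫⁻ p, ENNReal.ofReal ‖p.1 - p.2‖ ∂π
      ≤ ∫⁻ p, (‖T p.1 - p.1‖ₑ + ‖T p.2 - p.2‖ₑ) + ‖T p.1 - T p.2‖ₑ ∂π := by
        refine lintegral_mono fun p => ?_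
        rw [ofReal_norm]
        have e : p.1 - p.2 = -(T p.1 - p.1) + (T p.2 - p.2) + (T p.1 - T p.2) := by abel
        rw [e]
        refine (enorm_add_le _ _).trans (add_le_add_left ((enorm_add_le _ _).trans ?_) _)
        rw [enorm_neg]
    _ ≤ (ENNReal.ofReal ε + ENNReal.ofReal ε) + ENNReal.ofReal (K + 2 * ε) := by
        have m₀ : Measurable fun p : E d × E d => ‖T p.1 - p.1‖ₑ := hmT.comp measurable_fst
        have m₁ : Measurable fun p : E d × E d => ‖T p.2 - p.2‖ₑ := hmT.comp measurable_snd
        have m₀₁ : Measurable fun p : E d × E d => ‖T p.1 - p.1‖ₑ + ‖T p.2 - p.2‖ₑ := m₀.add m₁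
        rw [lintegral_add_left m₀₁, lintegral_add_left m₀]
        exact add_le_add (add_le_add c₀ c₁) c
    _ = ENNReal.ofReal (K + 4 * ε) := by
        rw [← ENNReal.ofReal_add hε hε, ← ENNReal.ofReal_add (by positivity) (by positivity)]
        congr 1
        ring

/-- The upper bound in the Kantorovich-Rubinstein duality. -/
theorem wasserstein₁_le_of_forall_lipschitz {ρ₀ ρ₁ : ProbabilityMeasure (E d)}
    (h₀ : Integrable (fun x : E d => x) (ρ₀ : Measure (E d)))
    (h₁ : Integrable (fun x : E d => x) (ρ₁ : Measure (E d))) {K : ℝ}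
    (hK : ∀ h : E d → ℝ, LipschitzWith 1 h →
      ∫ x, h x ∂(ρ₁ : Measure (E d)) - ∫ x, h x ∂(ρ₀ : Measure (E d)) ≤ K) :
    wasserstein₁ ρ₀ ρ₁ ≤ ENNReal.ofReal K := by
  have hK0 : 0 ≤ K := by simpa using hK 0 (LipschitzWith.const' 0)
  refine ENNReal.le_of_forall_pos_le_add fun δ hδ _ => ?_
  have hε : (0 : ℝ) < δ / 4 := by positivity
  -- Approximating the identity in `L¹(ρ₀ + ρ₁)` provides a single `T` that works for both measures.
  have ht := SimpleFunc.tendsto_approxOn_range_L1_enorm (f := fun x : E d => x) measurable_id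
    (h₀.add_measure h₁)
  obtain ⟨n, hn⟩ := (ht.eventually_le_const (ENNReal.ofReal_pos.2 hε)).exists
  rw [lintegral_add_measure] at hn
  refine (wasserstein₁_le_of_simpleFunc h₀ h₁ hK _ hε.le (le_self_add.trans hn)
    (le_add_self.trans hn)).trans (le_of_eq ?_)
  rw [mul_div_cancel₀ _ (by norm_num : (4 : ℝ) ≠ 0), ENNReal.ofReal_add hK0 δ.coe_nonneg,
    ENNReal.ofReal_coe_nnreal]

-- Reduction to smooth compactly supported test functions

open Filter

open scoped Convolution in
/-- A compactly supported `1`-Lipschitz function is a uniform limit of smooth ones. -/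
theorem exists_contDiff_lipschitz_approx {h : E d → ℝ} (hh : LipschitzWith 1 h)
    (hc : HasCompactSupport h) {δ : ℝ} (hδ : 0 < δ) :
    ∃ ψ : E d → ℝ, ContDiff ℝ ∞ ψ ∧ HasCompactSupport ψ ∧ LipschitzWith 1 ψ ∧
      ∀ x, |ψ x - h x| ≤ δ := by
  -- Convolution with a probability density preserves the Lipschitz constant, and support in the
  -- ball of radius `δ` moves a 1-Lipschitz function by at most `δ`.
  let φ : ContDiffBump (0 : E d) := ⟨δ / 2, δ, half_pos hδ, half_lt_self hδ⟩
  have hint : ∀ x, Integrable fun t => φ.normed volume t * h (x - t) := fun x =>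
    Continuous.integrable_of_hasCompactSupport
      (φ.continuous_normed.mul (hh.continuous.comp (continuous_const.sub continuous_id)))
      φ.hasCompactSupport_normed.mul_right
  refine ⟨φ.normed volume ⋆[ContinuousLinearMap.lsmul ℝ ℝ, volume] h,
    φ.hasCompactSupport_normed.contDiff_convolution_left _ φ.contDiff_normed
      hh.continuous.locallyIntegrable, φ.hasCompactSupport_normed.convolution _ hc,
    LipschitzWith.of_dist_le_mul fun x y => ?_, fun x => ?_⟩
  · simp only [convolution_def, ContinuousLinearMap.lsmul_apply, smul_eq_mul, NNReal.coe_one,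
      one_mul]
    rw [dist_eq_norm, ← integral_sub (hint x) (hint y)]
    calc ‖∫ t, φ.normed volume t * h (x - t) - φ.normed volume t * h (y - t)‖
        ≤ ∫ t, φ.normed volume t * dist x y := by
          refine norm_integral_le_of_norm_le (φ.integrable_normed.mul_const _)
            (ae_of_all _ fun t => ?_)
          rw [← mul_sub, norm_mul, Real.norm_of_nonneg (φ.nonneg_normed t)]
          refine mul_le_mul_of_nonneg_left ?_ (φ.nonneg_normed t)
          have := hh.dist_le_mul (x - t) (y - t)
          rwa [dist_sub_right, NNReal.coe_one, one_mul, dist_eq_norm] at this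
      _ = dist x y := by rw [integral_mul_const, φ.integral_normed, one_mul]
  · rw [← Real.dist_eq]
    refine φ.dist_normed_convolution_le hh.continuous.aestronglyMeasurable fun y hy => ?_
    have := hh.dist_le_mul y x
    rw [NNReal.coe_one, one_mul] at this
    exact this.trans (Metric.mem_ball.1 hy).le

/-- The truncation of `h` between `-(R - ‖x‖)₊` and `(R - ‖x‖)₊`. -/
def coneTruncation {V : Type*} [NormedAddCommGroup V] (h : V → ℝ) (R : ℝ) (x : V) : ℝ :=
  max (min (h x) (max 0 (R - ‖x‖))) (-max 0 (R - ‖x‖))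

section coneTruncation

variable {V : Type*} [NormedAddCommGroup V] {h : V → ℝ}

/-- The envelope has slope 1, and minima and maxima of 1-Lipschitz functions are 1-Lipschitz.
Multiplying by a cutoff would instead spoil the constant. -/
theorem lipschitzWith_coneTruncation (hh : LipschitzWith 1 h) (R : ℝ) :
    LipschitzWith 1 (coneTruncation h R) := by
  have h1 : LipschitzWith 1 fun x : V => max 0 (R - ‖x‖) := by
    have h2 : LipschitzWith 1 fun x : V => R - ‖x‖ := by
      simpa using (LipschitzWith.const R).sub lipschitzWith_one_norm
    exact h2.const_max 0
  simpa [coneTruncation] using! (hh.min h1).max h1.neg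

theorem hasCompactSupport_coneTruncation [ProperSpace V] (h : V → ℝ) (R : ℝ) :
    HasCompactSupport (coneTruncation h R) := by
  refine HasCompactSupport.intro (isCompact_closedBall (0 : V) R) fun x hx => ?_
  have h1 : R - ‖x‖ ≤ 0 := by
    rw [Metric.mem_closedBall, dist_zero_right, not_le] at hx
    linarith
  simp [coneTruncation, max_eq_left h1]

theorem norm_coneTruncation_le (h : V → ℝ) (R : ℝ) (x : V) :
    ‖coneTruncation h R x‖ ≤ ‖h x‖ := by
  have h0 : 0 ≤ max 0 (R - ‖x‖) := le_max_left _ _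
  simp only [coneTruncation, Real.norm_eq_abs]
  refine abs_le.2 ⟨?_, ?_⟩
  · exact le_max_of_le_left (le_min (neg_abs_le _) ((neg_nonpos.2 (abs_nonneg _)).trans h0))
  · exact max_le (min_le_of_left_le (le_abs_self _)) ((neg_nonpos.2 h0).trans (abs_nonneg _))

theorem tendsto_coneTruncation (h : V → ℝ) (x : V) :
    Tendsto (fun n : ℕ => coneTruncation h n x) atTop (𝓝 (h x)) := by
  refine tendsto_const_nhds.congr' ?_
  filter_upwards [tendsto_natCast_atTop_atTop.eventually_ge_atTop (|h x| + ‖x‖)] with n hn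
  have h1 : |h x| ≤ max 0 (n - ‖x‖) := le_max_of_le_right (by linarith)
  rw [coneTruncation, min_eq_left ((le_abs_self _).trans h1),
    max_eq_left ((neg_le_neg h1).trans (neg_abs_le _))]

end coneTruncation

/-- The upper bound in the Kantorovich-Rubinstein duality, with smooth compactly supported
test functions. -/
theorem wasserstein₁_le_of_forall_contDiff {ρ₀ ρ₁ : ProbabilityMeasure (E d)}
    (h₀ : Integrable (fun x : E d => x) (ρ₀ : Measure (E d)))
    (h₁ : Integrable (fun x : E d => x) (ρ₁ : Measure (E d))) {K : ℝ}
    (hK : ∀ ψ : E d → ℝ, ContDiff ℝ ∞ ψ → HasCompactSupport ψ → LipschitzWith 1 ψ →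
      ∫ x, ψ x ∂(ρ₁ : Measure (E d)) - ∫ x, ψ x ∂(ρ₀ : Measure (E d)) ≤ K) :
    wasserstein₁ ρ₀ ρ₁ ≤ ENNReal.ofReal K := by
  refine wasserstein₁_le_of_forall_lipschitz h₀ h₁ fun h hh => ?_
  have hcpt : ∀ g : E d → ℝ, LipschitzWith 1 g → HasCompactSupport g →
      ∫ x, g x ∂(ρ₁ : Measure (E d)) - ∫ x, g x ∂(ρ₀ : Measure (E d)) ≤ K := by
    intro g hg hgc
    refine le_of_forall_pos_le_add fun δ hδ => ?_
    obtain ⟨ψ, hψ, hψc, hψL, hψg⟩ := exists_contDiff_lipschitz_approx hg hgc (half_pos hδ)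
    have key : ∀ ρ : ProbabilityMeasure (E d),
        Integrable (fun x : E d => x) (ρ : Measure (E d)) →
        |∫ x, ψ x ∂(ρ : Measure (E d)) - ∫ x, g x ∂(ρ : Measure (E d))| ≤ δ / 2 := by
      intro ρ hρ
      rw [← integral_sub (hψL.integrable_of_integrable_id hρ) (hg.integrable_of_integrable_id hρ)]
      simpa using norm_integral_le_of_norm_le_const (μ := (ρ : Measure (E d)))
        (f := fun x => ψ x - g x) (C := δ / 2) (ae_of_all _ hψg)
    have e₀ := abs_le.1 (key ρ₀ h₀)
    have e₁ := abs_le.1 (key ρ₁ h₁)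
    linarith [hK ψ hψ hψc hψL]
  have ht : ∀ ρ : ProbabilityMeasure (E d), Integrable (fun x : E d => x) (ρ : Measure (E d)) →
      Tendsto (fun n : ℕ => ∫ x, coneTruncation h n x ∂(ρ : Measure (E d))) atTop
        (𝓝 (∫ x, h x ∂(ρ : Measure (E d)))) := fun ρ hρ =>
    tendsto_integral_of_dominated_convergence (fun x => ‖h x‖)
      (fun n => (lipschitzWith_coneTruncation hh n).continuous.aestronglyMeasurable)
      (hh.integrable_of_integrable_id hρ).norm
      (fun n => ae_of_all _ fun x => norm_coneTruncation_le h n x)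
      (ae_of_all _ fun x => tendsto_coneTruncation h x)
  exact le_of_tendsto ((ht ρ₁ h₁).sub (ht ρ₀ h₀)) (Eventually.of_forall fun n =>
    hcpt _ (lipschitzWith_coneTruncation hh n) (hasCompactSupport_coneTruncation h n))

-- Bounding the weighted flux by the action

/-- Young's inequality for the action density `α`. -/
theorem two_mul_mul_ofReal_le_alpha {κ : ℝ} (hκ : 0 < κ) {a : ℝ} {s r : ℝ}
    (hr : 0 ≤ r) :
    2 * (ENNReal.ofReal a * ENNReal.ofReal s)
      ≤ ENNReal.ofReal κ * alpha s r
        + ENNReal.ofReal κ⁻¹ * (ENNReal.ofReal (a ^ 2) * ENNReal.ofReal r) := by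
  rcases le_or_gt a 0 with ha | ha
  · simp [ENNReal.ofReal_of_nonpos ha]
  rcases le_or_gt s 0 with hs | hs
  · simp [ENNReal.ofReal_of_nonpos hs]
  -- Positive flux density over a vanishing reference density is harmless: there `α = ∞`.
  rcases hr.eq_or_lt with rfl | hr
  · simp [alpha, hs.not_ge, ENNReal.mul_top, hκ]
  · rw [alpha, if_pos hr, max_eq_right hs.le, ← ENNReal.ofReal_mul ha.le,
      ← ENNReal.ofReal_mul hκ.le, ← ENNReal.ofReal_mul (sq_nonneg a),
      ← ENNReal.ofReal_mul (inv_nonneg.2 hκ.le), ← ENNReal.ofReal_add (by positivity)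
      (by positivity), ← ENNReal.ofReal_ofNat, ← ENNReal.ofReal_mul (by norm_num)]
    refine ENNReal.ofReal_le_ofReal ?_
    have h : 0 ≤ (κ * s - a * r) ^ 2 / (κ * r) := by positivity
    have e : (κ * s - a * r) ^ 2 / (κ * r)
        = κ * (s ^ 2 / r) + κ⁻¹ * (a ^ 2 * r) - 2 * (a * s) := by
      field_simp
      ring
    linarith

/-- On a `μ`-null set the density of `μ` integrates to at most `μ` of that set, hence vanishes
almost everywhere there; the separating set and its complement handle the two measures. Consequently
the densities of `j⁺` and `j⁻` are the positive and negative parts of their difference. -/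
theorem _root_.MeasureTheory.Measure.MutuallySingular.rnDeriv_eq_zero_or {α : Type*}
    [MeasurableSpace α] {μ ν lam : Measure α} (h : μ ⟂ₘ ν) :
    ∀ᵐ x ∂lam, μ.rnDeriv lam x = 0 ∨ ν.rnDeriv lam x = 0 := by
  obtain ⟨s, hs, hμ, hν⟩ := h
  have key : ∀ (m : Measure α) (t : Set α), MeasurableSet t → m t = 0 →
      ∀ᵐ x ∂lam, x ∈ t → m.rnDeriv lam x = 0 := fun m t ht hm => by
    have h1 : ∫⁻ x in t, m.rnDeriv lam x ∂lam = 0 :=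
      le_antisymm ((Measure.setLIntegral_rnDeriv_le t).trans hm.le) zero_le
    exact (setLIntegral_eq_zero_iff ht (Measure.measurable_rnDeriv m lam)).1 h1
  filter_upwards [key μ s hs hμ, key ν sᶜ hs.compl hν] with x h1 h2
  by_cases hx : x ∈ s
  · exact Or.inl (h1 hx)
  · exact Or.inr (h2 hx)

theorem IsWeight.aemeasurable {η : E d × E d → ℝ≥0} (hη : IsWeight η)
    (ν : Measure (E d × E d)) :
    AEMeasurable (fun p => (η p : ℝ≥0∞)) (ν.restrict (edgeSet η)) :=
  (hη.continuousOn.aemeasurable hη.measurableSet_edgeSet).coe_nnreal_ennreal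

theorem IsWeight.measurable_indicator {η : E d × E d → ℝ≥0} (hη : IsWeight η) :
    Measurable ((edgeSet η).indicator fun p => (η p : ℝ≥0∞)) := by
  classical
  rw [← piecewise_eq_indicator]
  exact (ENNReal.continuous_coe.comp_continuousOn hη.continuousOn).measurable_piecewise
    continuousOn_const hη.measurableSet_edgeSet

theorem measurable_ofReal_norm_sub_sq :
    Measurable fun p : E d × E d => ENNReal.ofReal (‖p.1 - p.2‖ ^ 2) := by
  fun_prop

theorem MomentBound.lintegral_sq_le {η : E d × E d → ℝ≥0} {μ : Measure (E d)} {C : ℝ}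
    (hA : MomentBound η μ C) (x : E d) :
    ∫⁻ y, ENNReal.ofReal (‖x - y‖ ^ 2) * (η (x, y) : ℝ≥0∞) ∂μ ≤ ENNReal.ofReal C := by
  refine (lintegral_mono fun y => ?_).trans (hA x)
  gcongr
  exact le_max_left _ _

theorem lintegral_gamma₁_le {η : E d × E d → ℝ≥0} (hη : IsWeight η) {μ : Measure (E d)}
    [SigmaFinite μ] {C : ℝ} (hA : MomentBound η μ C) (ρ : Measure (E d))
    [IsProbabilityMeasure ρ] :
    ∫⁻ p in edgeSet η, ENNReal.ofReal (‖p.1 - p.2‖ ^ 2) * (η p : ℝ≥0∞)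
      ∂gamma₁ (edgeSet η) μ ρ ≤ ENNReal.ofReal C := by
  have hm : Measurable fun p : E d × E d => ENNReal.ofReal (‖p.1 - p.2‖ ^ 2)
      * (edgeSet η).indicator (fun p => (η p : ℝ≥0∞)) p :=
    measurable_ofReal_norm_sub_sq.mul hη.measurable_indicator
  rw [gamma₁, Measure.restrict_restrict hη.measurableSet_edgeSet, inter_self,
    ← lintegral_indicator hη.measurableSet_edgeSet]
  simp only [indicator_mul_right]
  rw [lintegral_prod _ hm.aemeasurable]
  calc _ ≤ ∫⁻ x, ENNReal.ofReal C ∂ρ := by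
        refine lintegral_mono fun x => (lintegral_mono fun y => ?_).trans (hA.lintegral_sq_le x)
        dsimp only
        gcongr
        exact indicator_le_self _ _ _
    _ = ENNReal.ofReal C := by simp

/-- Here `ρ` sits in the second variable, so Tonelli is applied in the opposite order and the
symmetry of `η` on `G` turns the inner integral into (A1) at `y`. -/
theorem lintegral_gamma₂_le {η : E d × E d → ℝ≥0} (hη : IsWeight η) {μ : Measure (E d)}
    [SigmaFinite μ] {C : ℝ} (hA : MomentBound η μ C) (ρ : Measure (E d))
    [IsProbabilityMeasure ρ] :
    ∫⁻ p in edgeSet η, ENNReal.ofReal (‖p.1 - p.2‖ ^ 2) * (η p : ℝ≥0∞)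
      ∂gamma₂ (edgeSet η) μ ρ ≤ ENNReal.ofReal C := by
  have hm : Measurable fun p : E d × E d => ENNReal.ofReal (‖p.1 - p.2‖ ^ 2)
      * (edgeSet η).indicator (fun p => (η p : ℝ≥0∞)) p :=
    measurable_ofReal_norm_sub_sq.mul hη.measurable_indicator
  rw [gamma₂, Measure.restrict_restrict hη.measurableSet_edgeSet, inter_self,
    ← lintegral_indicator hη.measurableSet_edgeSet]
  simp only [indicator_mul_right]
  rw [lintegral_prod_symm _ hm.aemeasurable]
  calc _ ≤ ∫⁻ y, ENNReal.ofReal C ∂ρ := by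
        refine lintegral_mono fun y => (lintegral_mono fun x => ?_).trans (hA.lintegral_sq_le y)
        dsimp only
        rw [norm_sub_rev]
        gcongr
        by_cases h : (x, y) ∈ edgeSet η
        · rw [indicator_of_mem h, ← hη.symm _ h]
          rfl
        · rw [indicator_of_notMem h]
          exact zero_le
    _ = ENNReal.ofReal C := by simp

theorem lintegral_restrict_eq_rnDeriv {α : Type*} [MeasurableSpace α] {ν lam : Measure α}
    [SigmaFinite ν] [SigmaFinite lam] (h : ν ≪ lam) {s : Set α} (hs : MeasurableSet s)
    {f : α → ℝ≥0∞} (hf : AEMeasurable f (lam.restrict s)) :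
    ∫⁻ x in s, f x ∂ν = ∫⁻ x in s, f x * ENNReal.ofReal (ν.rnDeriv lam x).toReal ∂lam := by
  nth_rw 1 [← Measure.withDensity_rnDeriv_eq ν lam h]
  rw [restrict_withDensity hs,
    lintegral_withDensity_eq_lintegral_mul₀ (Measure.measurable_rnDeriv ν lam).aemeasurable hf]
  refine lintegral_congr_ae (ae_restrict_of_ae ?_)
  filter_upwards [Measure.rnDeriv_lt_top ν lam] with x hx
  rw [Pi.mul_apply, ENNReal.ofReal_toReal hx.ne, mul_comm]

/-- Young's inequality holds pointwise with `a = |x - y|` and is integrated against `η dλ`. The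
parameter `κ` stays free, to be optimised after integrating in time. -/
theorem two_mul_lintegral_le_action {η : E d × E d → ℝ≥0} (hη : IsWeight η) {μ : Measure (E d)}
    [SigmaFinite μ] {C : ℝ} (hA : MomentBound η μ C) (ρ : Measure (E d))
    [IsProbabilityMeasure ρ] (j : Flux (edgeSet η)) {κ : ℝ} (hκ : 0 < κ) :
    2 * ∫⁻ p in edgeSet η, ENNReal.ofReal ‖p.1 - p.2‖ * (η p : ℝ≥0∞) ∂j.totalVariation
      ≤ ENNReal.ofReal κ * (2 * action η μ ρ j)
        + ENNReal.ofReal κ⁻¹ * (ENNReal.ofReal C + ENNReal.ofReal C) := by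
  have := j.sigmaFinite_pos
  have := j.sigmaFinite_neg
  have hG := hη.measurableSet_edgeSet
  have : SigmaFinite (gamma₁ (edgeSet η) μ ρ) := by unfold gamma₁; infer_instance
  have : SigmaFinite (gamma₂ (edgeSet η) μ ρ) := by unfold gamma₂; infer_instance
  rw [action, actionWith, ← mul_assoc 2 (1 / 2 : ℝ≥0∞), one_div,
    ENNReal.mul_inv_cancel two_ne_zero ENNReal.ofNat_ne_top, one_mul]
  refine le_trans ?_ (add_le_add_right (mul_le_mul_right
    (add_le_add (lintegral_gamma₁_le hη hA ρ) (lintegral_gamma₂_le hη hA ρ)) _) _)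
  rw [Flux.totalVariation]
  set lam := gamma₁ (edgeSet η) μ ρ + gamma₂ (edgeSet η) μ ρ + (j.pos + j.neg)
  have hac₁ : gamma₁ (edgeSet η) μ ρ ≪ lam :=
    (Measure.AbsolutelyContinuous.rfl.add_right _).add_right _
  have hac₂ : gamma₂ (edgeSet η) μ ρ ≪ lam :=
    (Measure.absolutelyContinuous_of_le (Measure.le_add_left le_rfl)).add_right _
  have hacp : j.pos ≪ lam :=
    Measure.absolutelyContinuous_of_le (Measure.le_add_left (Measure.le_add_right le_rfl))
  have hacn : j.neg ≪ lam :=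
    Measure.absolutelyContinuous_of_le (Measure.le_add_left (Measure.le_add_left le_rfl))
  have hηm := hη.aemeasurable lam
  have ha : AEMeasurable (fun p : E d × E d => ENNReal.ofReal ‖p.1 - p.2‖ * (η p : ℝ≥0∞))
      (lam.restrict (edgeSet η)) :=
    (by fun_prop : Measurable fun p : E d × E d => ENNReal.ofReal ‖p.1 - p.2‖).aemeasurable.mul
      hηm
  have ha2 : AEMeasurable (fun p : E d × E d => ENNReal.ofReal (‖p.1 - p.2‖ ^ 2) * (η p : ℝ≥0∞))
      (lam.restrict (edgeSet η)) := measurable_ofReal_norm_sub_sq.aemeasurable.mul hηm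
  have hrn : ∀ ν : Measure (E d × E d), AEMeasurable
      (fun p => ENNReal.ofReal (ν.rnDeriv lam p).toReal) (lam.restrict (edgeSet η)) := fun ν =>
    (Measure.measurable_rnDeriv ν lam).ennreal_toReal.ennreal_ofReal.aemeasurable
  have hf : ∀ ν : Measure (E d × E d), AEMeasurable
      (fun p => ENNReal.ofReal ‖p.1 - p.2‖ * (η p : ℝ≥0∞)
        * ENNReal.ofReal (ν.rnDeriv lam p).toReal) (lam.restrict (edgeSet η)) := fun ν =>
    ha.mul (hrn ν)
  have hf2 : ∀ ν : Measure (E d × E d), AEMeasurable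
      (fun p => ENNReal.ofReal (‖p.1 - p.2‖ ^ 2) * (η p : ℝ≥0∞)
        * ENNReal.ofReal (ν.rnDeriv lam p).toReal) (lam.restrict (edgeSet η)) := fun ν =>
    ha2.mul (hrn ν)
  rw [Measure.restrict_add, lintegral_add_measure, lintegral_restrict_eq_rnDeriv hacp hG ha,
    lintegral_restrict_eq_rnDeriv hacn hG ha, lintegral_restrict_eq_rnDeriv hac₁ hG ha2,
    lintegral_restrict_eq_rnDeriv hac₂ hG ha2, ← lintegral_add_left' (hf _),
    ← lintegral_add_left' (hf2 _), ← lintegral_const_mul' _ _ ENNReal.ofNat_ne_top,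
    ← lintegral_const_mul' _ _ ENNReal.ofReal_ne_top,
    ← lintegral_const_mul' _ _ ENNReal.ofReal_ne_top]
  -- Splitting off the quadratic term needs only its own measurability, not that of the `α` term.
  refine le_trans ?_ (lintegral_add_right' _ (((hf2 _).add (hf2 _)).const_mul _)).le
  refine lintegral_mono_ae (ae_restrict_of_ae ?_)
  filter_upwards [j.mutuallySingular.rnDeriv_eq_zero_or (lam := lam)] with p hp
  set a := ‖p.1 - p.2‖
  set s₁ := (j.pos.rnDeriv lam p).toReal with hs₁
  set s₂ := (j.neg.rnDeriv lam p).toReal with hs₂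
  set r₁ := ((gamma₁ (edgeSet η) μ ρ).rnDeriv lam p).toReal
  set r₂ := ((gamma₂ (edgeSet η) μ ρ).rnDeriv lam p).toReal
  have hs₁0 : 0 ≤ s₁ := ENNReal.toReal_nonneg
  have hs₂0 : 0 ≤ s₂ := ENNReal.toReal_nonneg
  have hsplit : ENNReal.ofReal s₁ = ENNReal.ofReal (s₁ - s₂) ∧
      ENNReal.ofReal s₂ = ENNReal.ofReal (-(s₁ - s₂)) := by
    rcases hp with h | h
    · have : s₁ = 0 := by rw [hs₁, h, ENNReal.toReal_zero]
      rw [this, ENNReal.ofReal_of_nonpos (show 0 - s₂ ≤ 0 by linarith)]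
      simp
    · have : s₂ = 0 := by rw [hs₂, h, ENNReal.toReal_zero]
      rw [this, ENNReal.ofReal_of_nonpos (show -(s₁ - 0) ≤ 0 by linarith)]
      simp
  have y₁ := two_mul_mul_ofReal_le_alpha hκ (a := a) (s := s₁ - s₂) (r := r₁)
    ENNReal.toReal_nonneg
  have y₂ := two_mul_mul_ofReal_le_alpha hκ (a := a) (s := -(s₁ - s₂)) (r := r₂)
    ENNReal.toReal_nonneg
  rw [hsplit.1, hsplit.2]
  have := mul_le_mul_left (add_le_add y₁ y₂) (η p : ℝ≥0∞)
  calc _ = _ := ?_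
    _ ≤ _ := this
    _ = _ := ?_
  · ring
  · simp only [Pi.add_apply]
    ring

/-! ### Time cutoffs -/

/-- The smooth step that increases from `0` to `1` on `[a, a + ℓ]`. -/
def smoothStep (a ℓ t : ℝ) : ℝ := Real.smoothTransition ((t - a) / ℓ)

theorem contDiff_smoothStep (a ℓ : ℝ) : ContDiff ℝ ∞ (smoothStep a ℓ) :=
  Real.smoothTransition.contDiff.comp ((contDiff_id.sub contDiff_const).div_const ℓ)

theorem monotone_smoothStep (a : ℝ) {ℓ : ℝ} (hℓ : 0 < ℓ) : Monotone (smoothStep a ℓ) :=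
  fun _ _ h => Real.smoothTransition.monotone (by gcongr)

theorem smoothStep_eq_zero {a ℓ t : ℝ} (hℓ : 0 < ℓ) (ht : t ≤ a) : smoothStep a ℓ t = 0 :=
  Real.smoothTransition.zero_of_nonpos (div_nonpos_of_nonpos_of_nonneg (by linarith) hℓ.le)

theorem smoothStep_eq_one {a ℓ t : ℝ} (hℓ : 0 < ℓ) (ht : a + ℓ ≤ t) : smoothStep a ℓ t = 1 :=
  Real.smoothTransition.one_of_one_le (by rw [le_div_iff₀ hℓ]; linarith)

theorem deriv_smoothStep_eq_zero {a ℓ t : ℝ} (hℓ : 0 < ℓ) (ht : t ∉ Icc a (a + ℓ)) :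
    deriv (smoothStep a ℓ) t = 0 := by
  rw [mem_Icc, not_and_or, not_le, not_le] at ht
  rcases ht with ht | ht
  · have : smoothStep a ℓ =ᶠ[𝓝 t] fun _ => 0 := by
      filter_upwards [Iio_mem_nhds ht] with s hs using smoothStep_eq_zero hℓ (le_of_lt hs)
    rw [this.deriv_eq, deriv_const]
  · have : smoothStep a ℓ =ᶠ[𝓝 t] fun _ => 1 := by
      filter_upwards [Ioi_mem_nhds ht] with s hs using smoothStep_eq_one hℓ (le_of_lt hs)
    rw [this.deriv_eq, deriv_const]

/-- Integrating against the derivative of a smooth step that varies where `m` is close to `q`. -/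
theorem abs_integral_deriv_smoothStep_sub_le {m : ℝ → ℝ} (hm : ContinuousOn m (Icc 0 1))
    {a ℓ q δ : ℝ} (ha : 0 ≤ a) (hℓ : 0 < ℓ) (hal : a + ℓ ≤ 1)
    (hq : ∀ t ∈ Icc a (a + ℓ), |m t - q| ≤ δ) :
    |(∫ t in (0 : ℝ)..1, deriv (smoothStep a ℓ) t * m t) - q| ≤ δ := by
  have hd : Continuous (deriv (smoothStep a ℓ)) :=
    (contDiff_smoothStep a ℓ).continuous_deriv (by simp)
  have hone : ∫ t in (0 : ℝ)..1, deriv (smoothStep a ℓ) t = 1 := by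
    rw [intervalIntegral.integral_deriv_eq_sub
      (fun t _ => ((contDiff_smoothStep a ℓ).differentiable (by simp)) t)
      (hd.intervalIntegrable _ _), smoothStep_eq_one hℓ hal, smoothStep_eq_zero hℓ ha, sub_zero]
  have hi : IntervalIntegrable (fun t => deriv (smoothStep a ℓ) t * m t) volume 0 1 :=
    ContinuousOn.intervalIntegrable (by
      rw [uIcc_of_le zero_le_one]
      exact hd.continuousOn.mul hm)
  -- The derivative is a probability density on `[a, a + ℓ]`, so the error is an average of `m - q`
  -- over that interval.
  have e : (∫ t in (0 : ℝ)..1, deriv (smoothStep a ℓ) t * m t) - q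
      = ∫ t in (0 : ℝ)..1, deriv (smoothStep a ℓ) t * (m t - q) := by
    simp only [mul_sub]
    rw [intervalIntegral.integral_sub hi ((hd.intervalIntegrable _ _).mul_const q),
      intervalIntegral.integral_mul_const, hone, one_mul]
  calc |(∫ t in (0 : ℝ)..1, deriv (smoothStep a ℓ) t * m t) - q|
      ≤ ∫ t in (0 : ℝ)..1, deriv (smoothStep a ℓ) t * δ := by
        rw [e, ← Real.norm_eq_abs]
        refine intervalIntegral.norm_integral_le_of_norm_le zero_le_one
          (Filter.Eventually.of_forall fun t _ => ?_) ((hd.intervalIntegrable _ _).mul_const δ)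
        rw [norm_mul, Real.norm_of_nonneg (monotone_smoothStep a hℓ).deriv_nonneg]
        by_cases ht : t ∈ Icc a (a + ℓ)
        · exact mul_le_mul_of_nonneg_left (hq t ht) (monotone_smoothStep a hℓ).deriv_nonneg
        · simp [deriv_smoothStep_eq_zero hℓ ht]
    _ = δ := by rw [intervalIntegral.integral_mul_const, hone, one_mul]

/-- Smooth cutoffs in time recover the boundary values of a continuous function. -/
theorem exists_time_cutoff {m : ℝ → ℝ} (hm : ContinuousOn m (Icc 0 1)) {δ : ℝ} (hδ : 0 < δ) :
    ∃ θ : ℝ → ℝ, ContDiff ℝ ∞ θ ∧ (∀ t, |θ t| ≤ 1) ∧ HasCompactSupport θ ∧ tsupport θ ⊆ Ioo 0 1 ∧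
      |(∫ t in Ioo (0 : ℝ) 1, deriv θ t * m t) - (m 0 - m 1)| ≤ 2 * δ := by
  obtain ⟨ε, hε, hε4, h0, h1⟩ : ∃ ε : ℝ, 0 < ε ∧ ε ≤ 1 / 4 ∧
      (∀ t ∈ Icc 0 1, |t - 0| ≤ 2 * ε → |m t - m 0| ≤ δ) ∧
      (∀ t ∈ Icc 0 1, |t - 1| ≤ 2 * ε → |m t - m 1| ≤ δ) := by
    obtain ⟨ε₀, hε₀, h0⟩ := Metric.continuousOn_iff.1 hm 0 (by simp) δ hδ
    obtain ⟨ε₁, hε₁, h1⟩ := Metric.continuousOn_iff.1 hm 1 (by simp) δ hδ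
    simp only [Real.dist_eq] at h0 h1
    refine ⟨min (1 / 4) (min (ε₀ / 4) (ε₁ / 4)), by positivity, min_le_left _ _,
      fun t ht h => (h0 t ht (h.trans_lt ?_)).le, fun t ht h => (h1 t ht (h.trans_lt ?_)).le⟩
    · have := (min_le_right (1 / 4) (min (ε₀ / 4) (ε₁ / 4))).trans (min_le_left _ _)
      linarith
    · have := (min_le_right (1 / 4) (min (ε₀ / 4) (ε₁ / 4))).trans (min_le_right _ _)
      linarith
  -- A plateau rising on `[ε, 2ε]` and falling on `[1 - 2ε, 1 - ε]`; `ε ≤ 1/4` keeps the rise before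
  -- the fall. The two steps recover `m 0` and `-m 1`, each within `δ`.
  let θ : ℝ → ℝ := fun t => smoothStep ε ε t - smoothStep (1 - 2 * ε) ε t
  have hsupp : tsupport θ ⊆ Icc ε (1 - ε) := by
    refine closure_minimal (fun t ht => ?_) isClosed_Icc
    by_contra hmem
    rw [mem_Icc, not_and_or, not_le, not_le] at hmem
    refine ht ?_
    rcases hmem with h | h
    · simp only [θ]
      rw [smoothStep_eq_zero hε h.le, smoothStep_eq_zero hε (by linarith), sub_zero]
    · simp only [θ]
      rw [smoothStep_eq_one hε (by linarith), smoothStep_eq_one hε (by linarith), sub_self]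
  refine ⟨θ, (contDiff_smoothStep _ _).sub (contDiff_smoothStep _ _), fun t => ?_,
    isCompact_Icc.of_isClosed_subset (isClosed_tsupport θ) hsupp,
    hsupp.trans (Icc_subset_Ioo hε (by linarith)), ?_⟩
  · exact abs_sub_le_of_nonneg_of_le (Real.smoothTransition.nonneg _)
      (Real.smoothTransition.le_one _) (Real.smoothTransition.nonneg _)
      (Real.smoothTransition.le_one _)
  · have hdiff : ∀ a t, DifferentiableAt ℝ (smoothStep a ε) t := fun a t =>
      (contDiff_smoothStep a ε).differentiable (by simp) t
    have hi : ∀ a, IntervalIntegrable (fun t => deriv (smoothStep a ε) t * m t) volume 0 1 :=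
      fun a => ContinuousOn.intervalIntegrable (by
        rw [uIcc_of_le zero_le_one]
        exact ((contDiff_smoothStep a ε).continuous_deriv (by simp)).continuousOn.mul hm)
    have e : ∀ t, deriv θ t * m t
        = deriv (smoothStep ε ε) t * m t - deriv (smoothStep (1 - 2 * ε) ε) t * m t := fun t => by
      rw [← sub_mul]
      congr 1
      exact deriv_fun_sub (hdiff _ _) (hdiff _ _)
    rw [← integral_Ioc_eq_integral_Ioo, ← intervalIntegral.integral_of_le zero_le_one]
    simp only [e]
    rw [intervalIntegral.integral_sub (hi _) (hi _)]
    have b0 := abs_le.1 (abs_integral_deriv_smoothStep_sub_le hm (a := ε) (ℓ := ε) (q := m 0)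
      (δ := δ) hε.le hε (by linarith) fun t ht => h0 t ⟨by linarith [ht.1], by linarith [ht.2]⟩
        (abs_le.2 ⟨by linarith [ht.1], by linarith [ht.2]⟩))
    have b1 := abs_le.1 (abs_integral_deriv_smoothStep_sub_le hm (a := 1 - 2 * ε) (ℓ := ε)
      (q := m 1) (δ := δ) (by linarith) hε (by linarith) fun t ht =>
        h1 t ⟨by linarith [ht.1], by linarith [ht.2]⟩
        (abs_le.2 ⟨by linarith [ht.1], by linarith [ht.2]⟩))
    exact abs_le.2 ⟨by linarith, by linarith⟩

/-! ### Testing the continuity equation -/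

theorem Flux.enorm_integral_le {G : Set (E d × E d)} (j : Flux G) (f : E d × E d → ℝ) :
    ‖j.integral f‖ₑ ≤ ∫⁻ p in G, ‖f p‖ₑ ∂j.totalVariation := by
  rw [totalVariation, Measure.restrict_add, lintegral_add_measure, Flux.integral]
  exact enorm_sub_le.trans (add_le_add (enorm_integral_le_lintegral_enorm _)
    (enorm_integral_le_lintegral_enorm _))

theorem continuousOn_integral_of_hasCompactSupport {ρ : ℝ → ProbabilityMeasure (E d)} {s : Set ℝ}
    (hρ : ContinuousOn ρ s) {ψ : E d → ℝ} (hψ : Continuous ψ) (hc : HasCompactSupport ψ) :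
    ContinuousOn (fun t => ∫ x, ψ x ∂(ρ t : Measure (E d))) s := by
  obtain ⟨C, hC⟩ := hc.exists_bound_of_continuous hψ
  exact (ProbabilityMeasure.continuous_integral_boundedContinuousFunction
    (BoundedContinuousFunction.ofNormedAddCommGroup ψ hψ C hC)).comp_continuousOn hρ

/-- Testing with `θ(t) ψ(x)` leaves only the boundary values in time, up to `δ`. The flux term is
bounded using `|θ| ≤ 1` and the Lipschitz bound, and the ½ in the weak formulation turns `2B` into
`B`. -/
theorem IsWeakSolution.integral_sub_le {η : E d × E d → ℝ≥0}
    {ρ : ℝ → ProbabilityMeasure (E d)} {j : ℝ → Flux (edgeSet η)}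
    (hsol : IsWeakSolution η 1 ρ j) {ψ : E d → ℝ} (hψ : ContDiff ℝ ∞ ψ)
    (hc : HasCompactSupport ψ) (hL : LipschitzWith 1 ψ) {B : ℝ} (hB : 0 ≤ B)
    (hBj : ∫⁻ t in Ioo (0 : ℝ) 1, ∫⁻ p in edgeSet η, ENNReal.ofReal ‖p.1 - p.2‖ * (η p : ℝ≥0∞)
      ∂(j t).totalVariation ≤ ENNReal.ofReal (2 * B)) :
    ∫ x, ψ x ∂(ρ 1 : Measure (E d)) - ∫ x, ψ x ∂(ρ 0 : Measure (E d)) ≤ B := by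
  refine le_of_forall_pos_le_add fun δ hδ => ?_
  obtain ⟨θ, hθ, hθ1, hθc, hθs, hθm⟩ := exists_time_cutoff
    (continuousOn_integral_of_hasCompactSupport hsol.continuousOn hψ.continuous hc) (half_pos hδ)
  have hts : tsupport (fun p : ℝ × E d => θ p.1 * ψ p.2) ⊆ tsupport θ ×ˢ tsupport ψ := by
    refine closure_minimal (fun p hp => ?_) ((isClosed_tsupport θ).prod (isClosed_tsupport ψ))
    exact ⟨subset_tsupport θ (left_ne_zero_of_mul hp), subset_tsupport ψ (right_ne_zero_of_mul hp)⟩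
  have hw := hsol.weak (fun p => θ p.1 * ψ p.2)
    ((hθ.comp contDiff_fst).mul (hψ.comp contDiff_snd))
    ((IsCompact.prod hθc hc).of_isClosed_subset (isClosed_tsupport _) hts)
    (hts.trans (prod_mono hθs (subset_univ _)))
  have hd : ∀ t x, deriv (fun s => θ s * ψ x) t = deriv θ t * ψ x := fun t x =>
    deriv_mul_const (hθ.differentiable (by simp) t) _
  simp only [hd, integral_const_mul] at hw
  have hJ : |∫ t in Ioo (0 : ℝ) 1,
      (j t).integral (fun p => nonlocalGrad (fun x => θ t * ψ x) p * (η p : ℝ))| ≤ 2 * B := by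
    rw [← Real.norm_eq_abs, ← ENNReal.ofReal_le_ofReal_iff (by positivity), ofReal_norm]
    refine ((enorm_integral_le_lintegral_enorm _).trans (lintegral_mono fun t =>
      ((j t).enorm_integral_le _).trans (lintegral_mono fun p => ?_))).trans hBj
    rw [enorm_mul, ← ofReal_norm, ← ofReal_norm (η p : ℝ), Real.norm_of_nonneg (η p).coe_nonneg,
      ENNReal.ofReal_coe_nnreal]
    gcongr
    have h := hL.dist_le_mul p.2 p.1
    rw [NNReal.coe_one, one_mul, dist_eq_norm, dist_comm, dist_eq_norm] at h
    rw [nonlocalGrad, ← mul_sub, norm_mul]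
    exact (mul_le_of_le_one_left (norm_nonneg _) (hθ1 t)).trans h
  have b1 := abs_le.1 hJ
  have b2 := abs_le.1 hθm
  linarith

-- Optimising Young's parameter along a curve

theorem HasFiniteSecondMoment.integrable {ρ : ProbabilityMeasure (E d)}
    (h : HasFiniteSecondMoment ρ) : Integrable (fun x : E d => x) (ρ : Measure (E d)) := by
  have h2 : Integrable (fun x : E d => ‖x‖ ^ 2) (ρ : Measure (E d)) :=
    ⟨(by fun_prop : Measurable fun x : E d => ‖x‖ ^ 2).aestronglyMeasurable,
      (hasFiniteIntegral_iff_ofReal (ae_of_all _ fun x => by positivity)).2 h⟩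
  refine ((integrable_const (1 : ℝ)).add h2).mono' measurable_id.aestronglyMeasurable
    (ae_of_all _ fun x => ?_)
  simp only [Pi.add_apply]
  nlinarith [sq_nonneg (‖x‖ - 1)]

/-- The total flux, weighted by the distance, is controlled by the total action. -/
theorem lintegral_flux_le_of_action_le {η : E d × E d → ℝ≥0} (hη : IsWeight η) {μ : Measure (E d)}
    [SigmaFinite μ] {C : ℝ} (hC : 0 ≤ C) (hA : MomentBound η μ C)
    (ρ : ℝ → ProbabilityMeasure (E d)) (j : ℝ → Flux (edgeSet η)) {A : ℝ} (hA0 : 0 ≤ A)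
    (hAj : ∫⁻ t in Icc (0 : ℝ) 1, action η μ (ρ t : Measure (E d)) (j t) ≤ ENNReal.ofReal A)
    {κ : ℝ} (hκ : 0 < κ) :
    ∫⁻ t in Ioo (0 : ℝ) 1, ∫⁻ p in edgeSet η, ENNReal.ofReal ‖p.1 - p.2‖ * (η p : ℝ≥0∞)
      ∂(j t).totalVariation ≤ ENNReal.ofReal (κ * A + κ⁻¹ * C) := by
  rw [← ENNReal.mul_le_mul_iff_right two_ne_zero ENNReal.ofNat_ne_top,
    ← lintegral_const_mul' _ _ ENNReal.ofNat_ne_top]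
  calc _ ≤ ∫⁻ t in Ioo (0 : ℝ) 1, (ENNReal.ofReal κ * (2 * action η μ (ρ t : Measure (E d)) (j t))
          + ENNReal.ofReal κ⁻¹ * (ENNReal.ofReal C + ENNReal.ofReal C)) :=
        lintegral_mono fun t => two_mul_lintegral_le_action hη hA _ (j t) hκ
    _ = ENNReal.ofReal κ * (2 * ∫⁻ t in Ioo (0 : ℝ) 1, action η μ (ρ t : Measure (E d)) (j t))
          + ENNReal.ofReal κ⁻¹ * (ENNReal.ofReal C + ENNReal.ofReal C) := by
        -- Only the constant summand has to be measurable, and finite factors come out of any lower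
        -- integral; measurability of the action in time is never needed.
        rw [lintegral_add_right _ measurable_const, lintegral_const_mul' _ _ ENNReal.ofReal_ne_top,
          lintegral_const_mul' _ _ ENNReal.ofNat_ne_top]
        simp
    _ ≤ ENNReal.ofReal κ * (2 * ENNReal.ofReal A)
          + ENNReal.ofReal κ⁻¹ * (ENNReal.ofReal C + ENNReal.ofReal C) := by
        gcongr
        exact (lintegral_mono_set Ioo_subset_Icc_self).trans hAj
    _ = _ := by
        rw [ENNReal.ofReal_add (by positivity) (by positivity), ENNReal.ofReal_mul hκ.le,
          ENNReal.ofReal_mul (inv_nonneg.2 hκ.le)]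
        ring

theorem wasserstein₁_le_of_mem_CE {η : E d × E d → ℝ≥0} (hη : IsWeight η) {μ : Measure (E d)}
    [SigmaFinite μ] {C : ℝ} (hC : 0 < C) (hA : MomentBound η μ C)
    {ρ₀ ρ₁ : ProbabilityMeasure (E d)} (h₀ : HasFiniteSecondMoment ρ₀)
    (h₁ : HasFiniteSecondMoment ρ₁)
    {c : (ℝ → ProbabilityMeasure (E d)) × (ℝ → Flux (edgeSet η))} (hc : c ∈ CE η ρ₀ ρ₁)
    {A : ℝ} (hA0 : 0 < A)
    (hAc : ∫⁻ t in Icc (0 : ℝ) 1, action η μ (c.1 t : Measure (E d)) (c.2 t)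
      ≤ ENNReal.ofReal A) :
    wasserstein₁ ρ₀ ρ₁ ≤ ENNReal.ofReal (√C * √A) := by
  obtain ⟨hsol, rfl, rfl⟩ := hc
  refine wasserstein₁_le_of_forall_contDiff h₀.integrable h₁.integrable fun ψ hψ hψc hψL =>
    hsol.integral_sub_le hψ hψc hψL (by positivity) ?_
  have hsC : 0 < √C := Real.sqrt_pos.2 hC
  have hsA : 0 < √A := Real.sqrt_pos.2 hA0
  -- The choice `κ = √C / √A` balances the two terms: `κA = C/κ = √C √A`.
  refine (lintegral_flux_le_of_action_le hη hC.le hA c.1 c.2 hA0.le hAc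
    (div_pos hsC hsA)).trans (ENNReal.ofReal_le_ofReal (le_of_eq ?_))
  nth_rw 2 [← Real.sq_sqrt hA0.le]
  nth_rw 3 [← Real.sq_sqrt hC.le]
  field_simp
  ring

end NonlocalTransport

end

theorem mainTheorem10 (d : ℕ) (η : NonlocalTransport.E d × NonlocalTransport.E d → ℝ≥0)
    (hη : NonlocalTransport.IsWeight η)
    (μ : Measure (NonlocalTransport.E d)) [SigmaFinite μ]
    (Cη : ℝ) (hC : 0 < Cη) (hA1 : NonlocalTransport.MomentBound η μ Cη)
    (ρ₀ ρ₁ : ProbabilityMeasure (NonlocalTransport.E d))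
    (h₀ : NonlocalTransport.HasFiniteSecondMoment ρ₀)
    (h₁ : NonlocalTransport.HasFiniteSecondMoment ρ₁) :
    NonlocalTransport.wasserstein₁ ρ₀ ρ₁
      ≤ ENNReal.ofReal (Real.sqrt (2 * Cη)) * NonlocalTransport.upwindCost η μ ρ₀ ρ₁ := by

  rw [NonlocalTransport.upwindCost]
  set I := ⨅ c ∈ NonlocalTransport.CE η ρ₀ ρ₁, ∫⁻ t in Icc (0 : ℝ) 1,
    NonlocalTransport.action η μ (c.1 t : Measure (NonlocalTransport.E d)) (c.2 t)
  have hk : 0 < √(2 * Cη) := Real.sqrt_pos.2 (by positivity)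
  rcases eq_or_ne I ⊤ with htop | htop
  · rw [htop, ENNReal.top_rpow_of_pos (by norm_num),
      ENNReal.mul_top (ENNReal.ofReal_pos.2 hk).ne']
    exact le_top
  -- The infimum need not be attained and may be 0, while the optimal `κ` requires positive action;
  -- so the bound is proved for every finite `x > I` and `x` decreases to `I`.
  have := nhdsGT_neBot_of_exists_gt ⟨⊤, htop.lt_top⟩
  have hlim : Filter.Tendsto (fun x : ℝ≥0∞ => ENNReal.ofReal √(2 * Cη) * x ^ (1 / 2 : ℝ)) (𝓝[>] I)
      (𝓝 (ENNReal.ofReal √(2 * Cη) * I ^ (1 / 2 : ℝ))) :=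
    (ENNReal.Tendsto.const_mul (ENNReal.continuous_rpow_const.tendsto I)
      (Or.inr ENNReal.ofReal_ne_top)).mono_left nhdsWithin_le_nhds
  refine ge_of_tendsto hlim ?_
  filter_upwards [self_mem_nhdsWithin, nhdsWithin_le_nhds (Iio_mem_nhds htop.lt_top)] with x hx hxt
  obtain ⟨c, hc⟩ := iInf_lt_iff.1 (mem_Ioi.1 hx)
  obtain ⟨hcCE, hc⟩ := iInf_lt_iff.1 hc
  have hxt' : x ≠ ⊤ := ne_of_lt hxt
  have hx0 : 0 < x.toReal := ENNReal.toReal_pos (pos_of_gt (mem_Ioi.1 hx)).ne' hxt'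
  refine (NonlocalTransport.wasserstein₁_le_of_mem_CE hη hC hA1 h₀ h₁ hcCE hx0
    (by rw [ENNReal.ofReal_toReal hxt']; exact hc.le)).trans ?_
  rw [ENNReal.ofReal_mul (Real.sqrt_nonneg _)]
  gcongr
  -- This is `Cη ≤ 2 * Cη`, the only place where the factor 2 enters.
  · linarith
  · rw [Real.sqrt_eq_rpow, ← ENNReal.ofReal_rpow_of_pos hx0, ENNReal.ofReal_toReal hxt']
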